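/- Consider three qubits with the non-interacting Hamiltonian $H=H_1\otimes I\otimes I+I\otimes H_2\otimes I+I\otimes I\otimes H_3$, where $H_l=E_l|0\rangle\langle 0|+(E_l+\alpha_l)|1\rangle\langle 1|$ with $E_l\in\mathbb{R}$ and $\alpha_l>0$ for $l=1,2,3$. Let $H_{23}=H_2\otimes I+I\otimes H_3$. For a Hamiltonian $K$ and a density operator $\sigma$ of a system, let the ergotropy be $W_K(\sigma)=\operatorname{Tr}[\sigma K]-\min_U\operatorname{Tr}[U\sigma U^\dagger K]$, the minimum being taken over all unitaries $U$ of the system. For a density operator $\rho$ on $\mathbb{C}^2\otimes\mathbb{C}^2\otimes\mathbb{C}^2$ with marginals $\rho_1=\operatorname{Tr}_{23}\rho$ and $\rho_{23}=\operatorname{Tr}_1\rho$, put $$\Delta_{1|23}=W_H(\rho)-W_{H_1}(\rho_1)-\operatorname{Tr}[\rho_{23}H_{23}]+E_g^{23},$$ where $E_g^{23}$ is the ground state energy (the smallest eigenvalue) of $H_{23}$. Suppose that $\rho$ is separable across the cut $1|23$, i.e. $\rho=\sum_i p_i\,|\psi_i\rangle\langle\psi_i|\otimes|\phi_i\rangle\langle\phi_i|$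 is a finite probabilistic mixture with unit vectors $\psi_i\in\mathbb{C}^2$ and $\phi_i\in\mathbb{C}^2\otimes\mathbb{C}^2$. Then: (a) if $\alpha_1<\alpha_2=\alpha_3$, then $\Delta_{1|23}\le 0$; (b) if $\alpha_1=\alpha_2=\alpha>\alpha_3$, then $\Delta_{1|23}\le(\alpha-\alpha_3)/2$. -/

import Mathlib

open scoped Kronecker Matrix ComplexOrder

namespace Ergotropy

variable {n a b : Type*} [Fintype n] [DecidableEq n] [Fintype a] [DecidableEq a]
  [Fintype b] [DecidableEq b]

/-- Density operators on the Hilbert space with orthonormal basis `n`: positive semidefinite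
operators of trace one. -/
def IsState (ρ : Matrix n n ℂ) : Prop :=
  ρ.PosSemidef ∧ ρ.trace = 1

/-- The projector `|ψ⟩⟨ψ|`. -/
def proj (ψ : n → ℂ) : Matrix n n ℂ :=
  Matrix.vecMulVec ψ (star ψ)

/-- `ρ` is separable across the cut `a`-vs-`b`: a (finite) probabilistic mixture of pure product
states `|ψᵢ⟩⟨ψᵢ| ⊗ |φᵢ⟩⟨φᵢ|`, with unit vectors `ψᵢ`, `φᵢ`. -/
def IsSeparable (ρ : Matrix (a × b) (a × b) ℂ) : Prop :=
  ∃ (k : ℕ) (p : Fin k → ℝ) (ψ : Fin k → a → ℂ) (φ : Fin k → b → ℂ),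
    (∀ i, 0 ≤ p i) ∧ ∑ i, p i = 1 ∧
    (∀ i, star (ψ i) ⬝ᵥ ψ i = 1) ∧ (∀ i, star (φ i) ⬝ᵥ φ i = 1) ∧
    ρ = ∑ i, (p i : ℂ) • (proj (ψ i) ⊗ₖ proj (φ i))

/-- The marginal on the first factor (the second factor is traced out). -/
def marginalFst (ρ : Matrix (a × b) (a × b) ℂ) : Matrix a a ℂ :=
  Matrix.of fun i j => ∑ k, ρ (i, k) (j, k)

/-- The marginal on the second factor (the first factor is traced out). -/
def marginalSnd (ρ : Matrix (a × b) (a × b) ℂ) : Matrix b b ℂ :=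
  Matrix.of fun i j => ∑ k, ρ (k, i) (k, j)

/-- The mean energy `Tr[ρ H]` (a real number for Hermitian `ρ` and `H`). -/
def energy (H ρ : Matrix n n ℂ) : ℝ :=
  (ρ * H).trace.re

/-- The set of mean energies `Tr[U ρ U† H]` that can be reached from `ρ` by a unitary `U`. -/
def reachableEnergies (H ρ : Matrix n n ℂ) : Set ℝ :=
  {x | ∃ U ∈ Matrix.unitaryGroup n ℂ, x = energy H (U * ρ * Uᴴ)}

/-- The ergotropy `W(ρ) = Tr[ρ H] - min_U Tr[U ρ U† H]`, over all unitaries `U`. The minimum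
is attained, see `isLeast_reachableEnergies`. -/
noncomputable def ergotropy (H ρ : Matrix n n ℂ) : ℝ :=
  energy H ρ - sInf (reachableEnergies H ρ)

/-- The ground state energy of a Hamiltonian: its smallest eigenvalue. -/
noncomputable def groundEnergy (H : Matrix n n ℂ) : ℝ :=
  sInf (spectrum ℝ H)

/-- The Hamiltonian `HA ⊗ I + I ⊗ HB` of two systems that do not interact. -/
def nonInteracting (HA : Matrix a a ℂ) (HB : Matrix b b ℂ) : Matrix (a × b) (a × b) ℂ :=
  HA ⊗ₖ (1 : Matrix b b ℂ) + (1 : Matrix a a ℂ) ⊗ₖ HB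

/-- `Δ_{A|B} = W(ρ) - W(ρ_A) - E(ρ_B) + E_g^B`, where `W(ρ)` is the ergotropy of the global
state for the Hamiltonian `HA ⊗ I + I ⊗ HB`, `W(ρ_A)` is the ergotropy of the marginal on `A`
for `HA`, `E(ρ_B)` is the energy of the marginal on `B` for `HB`, and `E_g^B` is the ground
state energy of `HB`. -/
noncomputable def ergotropicGap (HA : Matrix a a ℂ) (HB : Matrix b b ℂ)
    (ρ : Matrix (a × b) (a × b) ℂ) : ℝ :=
  ergotropy (nonInteracting HA HB) ρ - ergotropy HA (marginalFst ρ)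
    - energy HB (marginalSnd ρ) + groundEnergy HB

/-- The one-qubit Hamiltonian `E |0⟩⟨0| + (E + α) |1⟩⟨1|`. -/
noncomputable def qubitHamiltonian (E α : ℝ) : Matrix (Fin 2) (Fin 2) ℂ :=
  Matrix.diagonal ![(E : ℂ), ((E + α : ℝ) : ℂ)]

theorem isLeast_reachableEnergies (H ρ : Matrix n n ℂ) :
    IsLeast (reachableEnergies H ρ) (sInf (reachableEnergies H ρ)) := by
  have hK : IsCompact {U : Matrix n n ℂ | U ∈ Matrix.unitaryGroup n ℂ} := by
    have hbox : IsCompact (Set.univ.pi fun _ : n => Set.univ.pi fun _ : n =>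
        Metric.closedBall (0 : ℂ) 1) :=
      isCompact_univ_pi fun _ => isCompact_univ_pi fun _ => isCompact_closedBall _ _
    refine IsCompact.of_isClosed_subset (hbox : IsCompact (X := Matrix n n ℂ) _) ?_ ?_
    · have : {U : Matrix n n ℂ | U ∈ Matrix.unitaryGroup n ℂ} =
          {U : Matrix n n ℂ | U * Uᴴ = 1} := by
        ext U
        exact Matrix.mem_unitaryGroup_iff
      rw [this]
      exact isClosed_eq (by fun_prop) continuous_const
    · intro U hU i _ j _
      simpa using entry_norm_bound_of_unitary hU i j
  have himg : reachableEnergies H ρ = (fun U : Matrix n n ℂ => energy H (U * ρ * Uᴴ)) ''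
      {U : Matrix n n ℂ | U ∈ Matrix.unitaryGroup n ℂ} := by
    ext x
    constructor
    · rintro ⟨U, hU, rfl⟩
      exact ⟨U, hU, rfl⟩
    · rintro ⟨U, hU, rfl⟩
      exact ⟨U, hU, rfl⟩
  have hcont : Continuous fun U : Matrix n n ℂ => energy H (U * ρ * Uᴴ) := by
    have h1 : Continuous fun U : Matrix n n ℂ => U * ρ * Uᴴ * H :=
      ((continuous_id.matrix_mul continuous_const).matrix_mul
        continuous_id.matrix_conjTranspose).matrix_mul continuous_const
    exact Complex.continuous_re.comp h1.matrix_trace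
  rw [himg]
  exact (hK.image hcont).isLeast_sInf ⟨_, 1, one_mem (Matrix.unitaryGroup n ℂ), rfl⟩

end Ergotropy

namespace Ergotropy

/-! Mean energy is additive over marginals, so the gap equals the minimal reachable energy of `ρ₁`
plus the ground energy of `H₂₃` minus the minimal reachable energy of `ρ` (`ergotropicGap_eq`).
Separability enters through the reduction criterion `ρ ≤ ρ₁ ⊗ 1`: if `1 - q` is the larger
eigenvalue of `ρ₁`, then `ρ ≤ 1 - q` too, so no unitary puts more than `1 - q` of the population in
the ground level. With every excitation costing at least `δ`, at least `δ q` above the ground energy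
must remain (`le_sInf_reachableEnergies`), while `ρ₁` alone can be brought down to `E₁ + α₁ q`.
Hence the gap is at most `(α₁ - δ) q` with `q ≤ 1/2`; part (a) takes `δ = α₁`, part (b) `δ = α₃`. -/

theorem energy_diagonal {n : Type*} [Fintype n] [DecidableEq n] (e : n → ℝ) (σ : Matrix n n ℂ) :
    energy (Matrix.diagonal fun i => (e i : ℂ)) σ = ∑ i, (σ i i).re * e i := by
  simp [energy, Matrix.trace, Matrix.mul_diagonal]

theorem IsState.conj_unitary {n : Type*} [Fintype n] [DecidableEq n] {ρ U : Matrix n n ℂ}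
    (hρ : IsState ρ) (hU : U ∈ Matrix.unitaryGroup n ℂ) : IsState (U * ρ * Uᴴ) := by
  refine ⟨hρ.1.mul_mul_conjTranspose_same U, ?_⟩
  have h : Uᴴ * U = 1 := Matrix.mem_unitaryGroup_iff'.mp hU
  rw [Matrix.trace_mul_comm, ← Matrix.mul_assoc, h, Matrix.one_mul, hρ.2]

/-- If every level other than `i₀` lies at least `δ` above `e₀`, a state whose eigenvalues are at
most `m` cannot be brought below the energy `e₀ + δ (1 - m)`. -/
theorem le_sInf_reachableEnergies {n : Type*} [Fintype n] [DecidableEq n] {ρ : Matrix n n ℂ}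
    (hρ : IsState ρ) {m : ℝ} (hm : ((m : ℂ) • (1 : Matrix n n ℂ) - ρ).PosSemidef)
    (e : n → ℝ) (i₀ : n) {e₀ δ : ℝ} (hδ : 0 ≤ δ) (h₀ : e₀ ≤ e i₀)
    (h : ∀ i, i ≠ i₀ → e₀ + δ ≤ e i) :
    e₀ + δ * (1 - m) ≤
      sInf (reachableEnergies (Matrix.diagonal fun i => (e i : ℂ)) ρ) := by
  obtain ⟨U, hU, hx⟩ := (isLeast_reachableEnergies (Matrix.diagonal fun i => (e i : ℂ)) ρ).1
  rw [hx, energy_diagonal]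
  have hσ := hρ.conj_unitary hU
  have hmσ : ((m : ℂ) • (1 : Matrix n n ℂ) - U * ρ * Uᴴ).PosSemidef := by
    have hUU : U * Uᴴ = 1 := Matrix.mem_unitaryGroup_iff.mp hU
    simpa [Matrix.mul_sub, Matrix.sub_mul, hUU] using hm.mul_mul_conjTranspose_same U
  generalize U * ρ * Uᴴ = σ at hσ hmσ
  have hpos : ∀ i, 0 ≤ (σ i i).re := fun i =>
    (Complex.nonneg_iff.mp (hσ.1.diag_nonneg (i := i))).1
  have hle : (σ i₀ i₀).re ≤ m := by
    have := (Complex.nonneg_iff.mp (hmσ.diag_nonneg (i := i₀))).1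
    simpa using this
  have htr : ∑ i, (σ i i).re = 1 := by
    simpa [Matrix.trace] using congrArg Complex.re hσ.2
  -- Flatten the spectrum to `e₀` at `i₀` and `e₀ + δ` elsewhere: only the population of `i₀` then
  -- matters.
  have hbound : ∑ i, (σ i i).re * (e₀ + δ * (1 - if i = i₀ then 1 else 0)) ≤
      ∑ i, (σ i i).re * e i := by
    refine Finset.sum_le_sum fun i _ => mul_le_mul_of_nonneg_left ?_ (hpos i)
    by_cases hi : i = i₀
    · subst hi
      simpa using h₀
    · simpa [hi] using h i hi
  have heq : ∑ i, (σ i i).re * (e₀ + δ * (1 - if i = i₀ then 1 else 0)) =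
      e₀ + δ * (1 - (σ i₀ i₀).re) := by
    have : ∀ i, (σ i i).re * (e₀ + δ * (1 - if i = i₀ then 1 else 0)) =
        (σ i i).re * (e₀ + δ) - if i = i₀ then δ * (σ i i).re else 0 := by
      intro i
      split_ifs <;> ring
    simp only [this, Finset.sum_sub_distrib, ← Finset.sum_mul, htr, Finset.sum_ite_eq',
      Finset.mem_univ, if_true]
    ring
  have := mul_le_mul_of_nonneg_left hle hδ
  linarith

theorem posSemidef_proj {n : Type*} [Fintype n] (ψ : n → ℂ) : (proj ψ).PosSemidef :=
  Matrix.posSemidef_vecMulVec_self_star ψ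

theorem posSemidef_one_sub_proj {n : Type*} [Fintype n] [DecidableEq n] {φ : n → ℂ}
    (hφ : star φ ⬝ᵥ φ = 1) : (1 - proj φ).PosSemidef := by
  have hsq : proj φ * proj φ = proj φ := by
    simp [proj, Matrix.vecMulVec_mul_vecMulVec, hφ]
  have hherm : (proj φ)ᴴ = proj φ := (posSemidef_proj φ).isHermitian
  have h : 1 - proj φ = (1 - proj φ)ᴴ * (1 - proj φ) := by
    simp [hherm, Matrix.mul_sub, Matrix.sub_mul, hsq]
  rw [h]
  exact Matrix.posSemidef_conjTranspose_mul_self _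

theorem trace_proj {n : Type*} [Fintype n] (φ : n → ℂ) : (proj φ).trace = star φ ⬝ᵥ φ := by
  rw [proj, Matrix.trace_vecMulVec, dotProduct_comm]

section

variable {a b : Type*} [Fintype a] [Fintype b]

theorem marginalFst_sum_smul_kronecker {a b ι : Type*} [Fintype b] [Fintype ι] (p : ι → ℂ)
    (A : ι → Matrix a a ℂ) (B : ι → Matrix b b ℂ) :
    marginalFst (∑ i, p i • (A i ⊗ₖ B i)) = ∑ i, (p i * (B i).trace) • A i := by
  ext x y
  simp only [marginalFst, Matrix.of_apply, Matrix.sum_apply, Matrix.smul_apply,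
    Matrix.kroneckerMap_apply, Matrix.trace, Matrix.diag_apply, smul_eq_mul]
  rw [Finset.sum_comm]
  refine Finset.sum_congr rfl fun i _ => ?_
  rw [Finset.mul_sum, Finset.sum_mul]
  exact Finset.sum_congr rfl fun j _ => by ring

/-- The reduction criterion: a separable `ρ` satisfies `ρ ≤ ρ_A ⊗ 1`. -/
theorem IsSeparable.posSemidef_marginalFst_kronecker_one_sub [DecidableEq b]
    {ρ : Matrix (a × b) (a × b) ℂ} (h : IsSeparable ρ) :
    (marginalFst ρ ⊗ₖ (1 : Matrix b b ℂ) - ρ).PosSemidef := by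
  obtain ⟨k, p, ψ, φ, hp, -, -, hφ, rfl⟩ := h
  -- Both sides are mixtures over the same `ψ i`, so the difference is taken termwise in the second
  -- factor.
  have heq : marginalFst (∑ i, (p i : ℂ) • (proj (ψ i) ⊗ₖ proj (φ i))) ⊗ₖ (1 : Matrix b b ℂ) -
      ∑ i, (p i : ℂ) • (proj (ψ i) ⊗ₖ proj (φ i)) =
      ∑ i, (p i : ℂ) • (proj (ψ i) ⊗ₖ (1 - proj (φ i))) := by
    rw [marginalFst_sum_smul_kronecker]
    ext ⟨x, x'⟩ ⟨y, y'⟩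
    simp only [trace_proj, hφ, mul_one, Matrix.sub_apply, Matrix.kroneckerMap_apply,
      Matrix.sum_apply, Matrix.smul_apply, smul_eq_mul, Finset.sum_mul,
      ← Finset.sum_sub_distrib]
    exact Finset.sum_congr rfl fun i _ => by ring
  rw [heq]
  exact Matrix.posSemidef_sum _ fun i _ =>
    ((posSemidef_proj (ψ i)).kronecker (posSemidef_one_sub_proj (hφ i))).smul
      (Complex.zero_le_real.mpr (hp i))

theorem IsSeparable.isState_marginalFst {ρ : Matrix (a × b) (a × b) ℂ} (h : IsSeparable ρ) :
    IsState (marginalFst ρ) := by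
  obtain ⟨k, p, ψ, φ, hp, hsum, hψ, hφ, rfl⟩ := h
  rw [marginalFst_sum_smul_kronecker]
  simp only [trace_proj, hφ, mul_one]
  refine ⟨Matrix.posSemidef_sum _ fun i _ =>
    (posSemidef_proj (ψ i)).smul (Complex.zero_le_real.mpr (hp i)), ?_⟩
  simp only [Matrix.trace_sum, Matrix.trace_smul, trace_proj, hψ, smul_eq_mul, mul_one]
  exact_mod_cast hsum

/-- Chains `ρ ≤ ρ_A ⊗ 1 ≤ m`: a separable state is no purer, in largest eigenvalue, than its
marginal. Entangled states can violate this. -/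
theorem IsSeparable.posSemidef_smul_one_sub [DecidableEq a] [DecidableEq b]
    {ρ : Matrix (a × b) (a × b) ℂ} (h : IsSeparable ρ)
    {m : ℂ} (hm : (m • (1 : Matrix a a ℂ) - marginalFst ρ).PosSemidef) :
    (m • (1 : Matrix (a × b) (a × b) ℂ) - ρ).PosSemidef := by
  have heq : m • (1 : Matrix (a × b) (a × b) ℂ) - ρ =
      (m • (1 : Matrix a a ℂ) - marginalFst ρ) ⊗ₖ (1 : Matrix b b ℂ) +
        (marginalFst ρ ⊗ₖ (1 : Matrix b b ℂ) - ρ) := by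
    ext ⟨x, x'⟩ ⟨y, y'⟩
    by_cases hx : x = y <;> by_cases hx' : x' = y' <;> simp [hx, hx']
    abel
  rw [heq]
  exact (hm.kronecker Matrix.PosSemidef.one).add h.posSemidef_marginalFst_kronecker_one_sub

theorem energy_nonInteracting [DecidableEq a] [DecidableEq b]
    (HA : Matrix a a ℂ) (HB : Matrix b b ℂ)
    (ρ : Matrix (a × b) (a × b) ℂ) :
    energy (nonInteracting HA HB) ρ =
      energy HA (marginalFst ρ) + energy HB (marginalSnd ρ) := by
  have hA : (ρ * (HA ⊗ₖ (1 : Matrix b b ℂ))).trace = (marginalFst ρ * HA).trace := by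
    simp only [Matrix.trace, Matrix.diag_apply, Matrix.mul_apply, Fintype.sum_prod_type,
      Matrix.kroneckerMap_apply, marginalFst, Matrix.of_apply, Matrix.one_apply, mul_ite, mul_one,
      mul_zero, Finset.sum_ite_eq', Finset.mem_univ, if_true, Finset.sum_mul]
    exact Finset.sum_congr rfl fun i _ => Finset.sum_comm
  have hB : (ρ * ((1 : Matrix a a ℂ) ⊗ₖ HB)).trace = (marginalSnd ρ * HB).trace := by
    simp only [Matrix.trace, Matrix.diag_apply, Matrix.mul_apply, Fintype.sum_prod_type_right,
      Matrix.kroneckerMap_apply, marginalSnd, Matrix.of_apply, Matrix.one_apply, ite_mul, one_mul,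
      zero_mul, mul_ite, mul_zero, Finset.sum_ite_eq', Finset.mem_univ, if_true, Finset.sum_mul]
    exact Finset.sum_congr rfl fun i _ => Finset.sum_comm
  simp only [energy, nonInteracting, Matrix.mul_add, Matrix.trace_add, hA, hB, Complex.add_re]

theorem nonInteracting_diagonal {a b : Type*} [DecidableEq a] [DecidableEq b]
    (e : a → ℝ) (f : b → ℝ) :
    nonInteracting (Matrix.diagonal fun i => (e i : ℂ)) (Matrix.diagonal fun j => (f j : ℂ)) =
      Matrix.diagonal fun x : a × b => ((e x.1 + f x.2 : ℝ) : ℂ) := by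
  ext ⟨x, x'⟩ ⟨y, y'⟩
  by_cases hx : x = y <;> by_cases hx' : x' = y' <;>
    simp [nonInteracting, hx, hx']

theorem ergotropicGap_eq [DecidableEq a] [DecidableEq b]
    (HA : Matrix a a ℂ) (HB : Matrix b b ℂ)
    (ρ : Matrix (a × b) (a × b) ℂ) :
    ergotropicGap HA HB ρ = sInf (reachableEnergies HA (marginalFst ρ)) + groundEnergy HB -
      sInf (reachableEnergies (nonInteracting HA HB) ρ) := by
  rw [ergotropicGap, ergotropy, ergotropy, energy_nonInteracting]
  ring

end

/-- The ground energy enters the gap with a plus sign, so an upper bound suffices. -/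
theorem groundEnergy_diagonal_le {n : Type*} [Fintype n] [DecidableEq n] (e : n → ℝ) (i : n) :
    groundEnergy (Matrix.diagonal fun j => (e j : ℂ)) ≤ e i := by
  have hH : (Matrix.diagonal fun j => (e j : ℂ)).IsHermitian :=
    Matrix.isHermitian_diagonal_of_self_adjoint _ (by ext j; simp)
  refine csInf_le ?_ ?_
  · rw [hH.spectrum_real_eq_range_eigenvalues]
    exact (Set.finite_range _).bddBelow
  · rw [← spectrum.algebraMap_mem_iff ℂ, spectrum_diagonal]
    exact ⟨i, rfl⟩

theorem qubitHamiltonian_eq (E α : ℝ) :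
    qubitHamiltonian E α = Matrix.diagonal fun i => ((![E, E + α] i : ℝ) : ℂ) := by
  rw [qubitHamiltonian]
  congr 1
  ext i
  fin_cases i <;> rfl

/-- A qubit state has a smaller eigenvalue `q ≤ 1/2`, and its passive energy is at most
`E + α q`. -/
theorem IsState.exists_qubit_smaller_eigenvalue {σ : Matrix (Fin 2) (Fin 2) ℂ} (hσ : IsState σ) :
    ∃ q : ℝ, q ≤ 1 / 2 ∧
      (((1 - q : ℝ) : ℂ) • (1 : Matrix (Fin 2) (Fin 2) ℂ) - σ).PosSemidef ∧
      ∀ E α : ℝ, sInf (reachableEnergies (qubitHamiltonian E α) σ) ≤ E + α * q := by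
  -- Diagonalise with the larger eigenvalue on the lower level; if the eigenvalues come in the other
  -- order, compose with the bit flip.
  obtain ⟨V, hV, d, hd, hle⟩ : ∃ V ∈ Matrix.unitaryGroup (Fin 2) ℂ, ∃ d : Fin 2 → ℝ,
      V * σ * Vᴴ = Matrix.diagonal (fun i => (d i : ℂ)) ∧ d 1 ≤ d 0 := by
    have hH := hσ.1.isHermitian
    set W : Matrix (Fin 2) (Fin 2) ℂ := hH.eigenvectorUnitary.1
    have hW : W ∈ Matrix.unitaryGroup (Fin 2) ℂ := hH.eigenvectorUnitary.2
    have hspec : Wᴴ * σ * W = Matrix.diagonal (fun i => (hH.eigenvalues i : ℂ)) := by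
      have h := hH.conjStarAlgAut_star_eigenvectorUnitary
      simpa [Unitary.conjStarAlgAut_apply, Matrix.star_eq_conjTranspose, Function.comp_def]
        using h
    have hW' : Wᴴ ∈ Matrix.unitaryGroup (Fin 2) ℂ := Unitary.star_mem hW
    rcases le_total (hH.eigenvalues 1) (hH.eigenvalues 0) with hle | hle
    · exact ⟨Wᴴ, hW', hH.eigenvalues, by simpa using hspec, hle⟩
    · have hX : (!![0, 1; 1, 0] : Matrix (Fin 2) (Fin 2) ℂ) ∈ Matrix.unitaryGroup (Fin 2) ℂ := by
        rw [Matrix.mem_unitaryGroup_iff]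
        ext i j
        fin_cases i <;> fin_cases j <;> simp [Matrix.mul_apply, Matrix.star_eq_conjTranspose]
      refine ⟨!![0, 1; 1, 0] * Wᴴ, mul_mem hX hW', ![hH.eigenvalues 1, hH.eigenvalues 0], ?_,
        by simpa using hle⟩
      rw [Matrix.conjTranspose_mul, Matrix.conjTranspose_conjTranspose]
      have : !![0, 1; 1, 0] * Wᴴ * σ * (W * (!![0, 1; 1, 0] : Matrix (Fin 2) (Fin 2) ℂ)ᴴ) =
          !![0, 1; 1, 0] * (Wᴴ * σ * W) * (!![0, 1; 1, 0] : Matrix (Fin 2) (Fin 2) ℂ)ᴴ := by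
        simp only [Matrix.mul_assoc]
      rw [this, hspec]
      ext i j
      fin_cases i <;> fin_cases j <;> simp [Matrix.mul_apply, Matrix.vecMul_diagonal]
  have hτ := hσ.conj_unitary hV
  rw [hd] at hτ
  have hsum : d 0 + d 1 = 1 := by
    have := congrArg Complex.re hτ.2
    simpa [Matrix.trace, Fin.sum_univ_two] using this
  have hVV : Vᴴ * V = 1 := Matrix.mem_unitaryGroup_iff'.mp hV
  refine ⟨d 1, by linarith, ?_, fun E α => ?_⟩
  · have hback : σ = Vᴴ * Matrix.diagonal (fun i => (d i : ℂ)) * V := by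
      rw [← hd]
      calc σ = (Vᴴ * V) * σ * (Vᴴ * V) := by simp [hVV]
        _ = _ := by simp only [Matrix.mul_assoc]
    have hdiag : (((1 - d 1 : ℝ) : ℂ) • (1 : Matrix (Fin 2) (Fin 2) ℂ) -
        Matrix.diagonal (fun i => (d i : ℂ))).PosSemidef := by
      rw [Matrix.smul_one_eq_diagonal, Matrix.diagonal_sub, Matrix.posSemidef_diagonal_iff]
      intro i
      rw [← Complex.ofReal_sub, Complex.zero_le_real]
      fin_cases i <;> simp <;> linarith
    have h := hdiag.conjTranspose_mul_mul_same V
    rw [Matrix.mul_sub, Matrix.sub_mul, ← hback] at h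
    simpa [hVV] using h
  -- `V` serves as trial unitary, of energy `d 0 * E + d 1 * (E + α)`.
  · refine ((isLeast_reachableEnergies _ σ).2 ⟨V, hV, rfl⟩).trans_eq ?_
    rw [hd, qubitHamiltonian_eq, energy_diagonal]
    simp only [Fin.sum_univ_two, Matrix.diagonal_apply_eq, Complex.ofReal_re,
      Matrix.cons_val_zero, Matrix.cons_val_one]
    linear_combination E * hsum

/-- The gap of a separable three-qubit state, when `δ` is a lower bound for the three
excitation energies. -/
theorem IsSeparable.exists_ergotropicGap_le (E₁ E₂ E₃ α₁ α₂ α₃ : ℝ) {δ : ℝ} (hδ : 0 ≤ δ)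
    (h₁ : δ ≤ α₁) (h₂ : δ ≤ α₂) (h₃ : δ ≤ α₃)
    {ρ : Matrix (Fin 2 × (Fin 2 × Fin 2)) (Fin 2 × (Fin 2 × Fin 2)) ℂ}
    (hρ : IsState ρ) (hsep : IsSeparable ρ) :
    ∃ q : ℝ, q ≤ 1 / 2 ∧
      ergotropicGap (qubitHamiltonian E₁ α₁)
        (nonInteracting (qubitHamiltonian E₂ α₂) (qubitHamiltonian E₃ α₃)) ρ ≤ (α₁ - δ) * q := by
  obtain ⟨q, hq, hpsd, hpass⟩ := hsep.isState_marginalFst.exists_qubit_smaller_eigenvalue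
  refine ⟨q, hq, ?_⟩
  have hA := hpass E₁ α₁
  rw [ergotropicGap_eq]
  simp only [qubitHamiltonian_eq, nonInteracting_diagonal] at hA ⊢
  have hG := groundEnergy_diagonal_le
    (fun x : Fin 2 × Fin 2 => ![E₂, E₂ + α₂] x.1 + ![E₃, E₃ + α₃] x.2) (0, 0)
  -- Each of the seven other levels has at least one qubit excited, hence lies at least `δ` above
  -- the ground level.
  have hP := le_sInf_reachableEnergies hρ (hsep.posSemidef_smul_one_sub hpsd)
    (fun x : Fin 2 × (Fin 2 × Fin 2) =>
      ![E₁, E₁ + α₁] x.1 + (![E₂, E₂ + α₂] x.2.1 + ![E₃, E₃ + α₃] x.2.2))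
    (0, (0, 0)) (e₀ := E₁ + (E₂ + E₃)) hδ (by simp) (by
      rintro ⟨i, j, k⟩ hne
      fin_cases i <;> fin_cases j <;> fin_cases k <;> simp at hne ⊢ <;> linarith)
  simp only [Matrix.cons_val_zero] at hG
  linarith

end Ergotropy

theorem proposition2
    (E₁ E₂ E₃ α₁ α₂ α₃ : ℝ) (hα₁ : 0 < α₁) (hα₂ : 0 < α₂) (hα₃ : 0 < α₃)
    (ρ : Matrix (Fin 2 × (Fin 2 × Fin 2)) (Fin 2 × (Fin 2 × Fin 2)) ℂ)
    (hρ : Ergotropy.IsState ρ) (hsep : Ergotropy.IsSeparable ρ) :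
    (α₁ < α₂ → α₂ = α₃ →
      Ergotropy.ergotropicGap (Ergotropy.qubitHamiltonian E₁ α₁)
        (Ergotropy.nonInteracting (Ergotropy.qubitHamiltonian E₂ α₂)
          (Ergotropy.qubitHamiltonian E₃ α₃)) ρ ≤ 0) ∧
    (∀ α : ℝ, α₁ = α → α₂ = α → α₃ < α →
      Ergotropy.ergotropicGap (Ergotropy.qubitHamiltonian E₁ α₁)
        (Ergotropy.nonInteracting (Ergotropy.qubitHamiltonian E₂ α₂)
          (Ergotropy.qubitHamiltonian E₃ α₃)) ρ ≤ (α - α₃) / 2) := by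
  constructor
  · rintro h rfl
    -- With `δ = α₁` the coefficient of `q` vanishes.
    obtain ⟨q, -, hgap⟩ :=
      hsep.exists_ergotropicGap_le E₁ E₂ E₃ α₁ α₂ α₂ hα₁.le le_rfl h.le h.le hρ
    simpa using hgap
  · rintro α rfl rfl h
    obtain ⟨q, hq, hgap⟩ :=
      hsep.exists_ergotropicGap_le E₁ E₂ E₃ α₂ α₂ α₃ hα₃.le h.le h.le le_rfl hρ
    have := mul_le_mul_of_nonneg_left hq (sub_nonneg.mpr h.le)
    linarith
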